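/- Let $(G,\rho)$ be a stationary random graph; that is, $(G,\rho)$ is a random element of the space of isomorphism classes of rooted, connected, locally finite simple graphs (with the Borel $\sigma$-algebra of the local topology, generated by the events that the ball of radius $r$ around the root is isomorphic, as a rooted graph, to a given finite rooted graph), and $(G,X_1)$ has the same distribution as $(G,\rho)$, where $X_1$ is the position after one step of simple random walk on $G$ started from $\rho$. A function $h\colon V(G)\to\mathbb{R}$ is harmonic if its value at each vertex is the mean of its values at the neighbours of that vertex. Then, almost surely, the real vector space of bounded harmonic functions on $G$ is either $1$-dimensional or infinite-dimensional. (On the graph with a single vertex, the walk stays put and every function is harmonic.) -/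

import Mathlib

open MeasureTheory
open scoped ENNReal

/-- A rooted, connected, locally finite simple graph `(G, ρ)`. The vertex set may be finite or
infinite; connectedness and local finiteness force it to be countable, so `Type` loses nothing. -/
structure RootedGraph where
  V : Type
  graph : SimpleGraph V
  root : V
  connected : graph.Connected
  locallyFinite : ∀ v : V, (graph.neighborSet v).Finite

namespace RootedGraph

/-- The finite set of neighbours of a vertex. -/
noncomputable def nbrs (G : RootedGraph) (v : G.V) : Finset G.V :=
  (G.locallyFinite v).toFinset

/-- The same graph, rooted at another vertex. -/
def reroot (G : RootedGraph) (v : G.V) : RootedGraph where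
  V := G.V
  graph := G.graph
  root := v
  connected := G.connected
  locallyFinite := G.locallyFinite

/-- Isomorphism of rooted graphs: a graph isomorphism that maps root to root. -/
def Iso (G H : RootedGraph) : Prop :=
  ∃ e : G.graph ≃g H.graph, e G.root = H.root

theorem Iso.refl (G : RootedGraph) : G.Iso G := ⟨RelIso.refl _, rfl⟩

theorem Iso.symm {G H : RootedGraph} : G.Iso H → H.Iso G := by
  rintro ⟨e, he⟩
  exact ⟨e.symm, by rw [← he]; exact e.symm_apply_apply _⟩

theorem Iso.trans {G H K : RootedGraph} : G.Iso H → H.Iso K → G.Iso K := by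
  rintro ⟨e, he⟩ ⟨f, hf⟩
  exact ⟨e.trans f, by rw [← hf, ← he]; rfl⟩

instance setoid : Setoid RootedGraph where
  r := Iso
  iseqv := ⟨Iso.refl, Iso.symm, Iso.trans⟩

/-- The vertices of the closed ball of radius `r` around the root, in the graph metric. -/
def ball (G : RootedGraph) (r : ℕ) : Set G.V :=
  {v | G.graph.dist G.root v ≤ r}

theorem root_mem_ball (G : RootedGraph) (r : ℕ) : G.root ∈ G.ball r := by
  simp [ball]

/-- The balls of radius `r` around the roots of `G` and `H` are isomorphic as rooted graphs. -/
def BallIso (r : ℕ) (G H : RootedGraph) : Prop :=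
  ∃ e : G.graph.induce (G.ball r) ≃g H.graph.induce (H.ball r),
    e ⟨G.root, G.root_mem_ball r⟩ = ⟨H.root, H.root_mem_ball r⟩

end RootedGraph

/-- Unlabeled rooted graphs: rooted, connected, locally finite graphs up to rooted isomorphism. -/
def UnlabeledGraph : Type 1 := Quotient RootedGraph.setoid

namespace RootedGraph

/-- The isomorphism class of a rooted graph. -/
def toUnlabeled (G : RootedGraph) : UnlabeledGraph := Quotient.mk setoid G

end RootedGraph

/-- The Borel σ-algebra of the local topology. It is generated by the sets of all classes of rooted
graphs whose ball of radius `r` around the root is isomorphic to that of a given rooted graph; there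
are only countably many such sets, and they form a basis of the local topology. -/
instance UnlabeledGraph.measurableSpace : MeasurableSpace UnlabeledGraph :=
  MeasurableSpace.generateFrom
    {A | ∃ (r : ℕ) (H : RootedGraph),
      A = {x | ∃ G : RootedGraph, G.toUnlabeled = x ∧ G.BallIso r H}}

namespace RootedGraph

open Classical in
/-- The law of the simple random walk started from the root after one step: uniform on the
neighbours of the root. (On the graph with a single vertex, the walk stays where it is.) -/
noncomputable def walkStep (G : RootedGraph) : PMF G.V :=
  if h : (G.nbrs G.root).Nonempty then PMF.uniformOfFinset (G.nbrs G.root) h else PMF.pure G.root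

/-- For a fixed rooted graph `(G, ρ)`, the law of the unlabeled rooted graph `(G, X₁)`. -/
noncomputable def walkLaw (G : RootedGraph) : Measure UnlabeledGraph :=
  (G.walkStep.map fun v => (G.reroot v).toUnlabeled).toMeasure

theorem mem_nbrs {G : RootedGraph} {v w : G.V} : w ∈ G.nbrs v ↔ G.graph.Adj v w := by
  simp [nbrs]

theorem map_walkStep {G H : RootedGraph} (e : G.graph ≃g H.graph) (he : e G.root = H.root) :
    G.walkStep.map e = H.walkStep := by
  classical
  have hn : H.nbrs H.root = (G.nbrs G.root).map e.toEquiv.toEmbedding := by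
    ext w
    obtain ⟨v, rfl⟩ := e.surjective w
    rw [mem_nbrs, ← he, e.map_adj_iff, ← mem_nbrs]
    constructor
    · intro h
      exact Finset.mem_map.2 ⟨v, h, rfl⟩
    · intro h
      obtain ⟨u, hu, huv⟩ := Finset.mem_map.1 h
      have : u = v := e.injective huv
      exact this ▸ hu
  by_cases h : (G.nbrs G.root).Nonempty
  · have h' : (H.nbrs H.root).Nonempty := by rw [hn]; exact h.map
    rw [walkStep, walkStep, dif_pos h, dif_pos h']
    ext w
    obtain ⟨v, rfl⟩ := e.surjective w
    rw [PMF.map_apply, tsum_eq_single v]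
    · have hm : e v ∈ H.nbrs H.root ↔ v ∈ G.nbrs G.root := by
        rw [mem_nbrs, mem_nbrs, ← he, e.map_adj_iff]
      have hc : (H.nbrs H.root).card = (G.nbrs G.root).card := by
        rw [hn, Finset.card_map]
      simp only [if_true, PMF.uniformOfFinset_apply, hm, hc]
    · intro u hu
      exact if_neg fun h => hu (e.injective h.symm)
  · have h' : ¬ (H.nbrs H.root).Nonempty := by
      rw [hn, Finset.map_nonempty]; exact h
    rw [walkStep, walkStep, dif_neg h, dif_neg h', PMF.pure_map, he]

theorem walkLaw_eq_of_iso {G H : RootedGraph} (h : G.Iso H) : G.walkLaw = H.walkLaw := by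
  obtain ⟨e, he⟩ := h
  rw [walkLaw, walkLaw, ← map_walkStep e he, PMF.map_comp]
  congr 2
  funext v
  exact Quotient.sound ⟨e, rfl⟩

/-- The real vector space of bounded harmonic functions on the graph: the bounded `h : V → ℝ` whose
value at every vertex is the mean of its values at the neighbours (the equation is written
multiplied by the degree). It does not depend on the root. -/
def boundedHarmonic (G : RootedGraph) : Submodule ℝ (G.V → ℝ) where
  carrier := {h | (∃ C : ℝ, ∀ v, |h v| ≤ C) ∧
    ∀ v, ∑ w ∈ G.nbrs v, h w = ((G.nbrs v).card : ℝ) * h v}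
  zero_mem' := ⟨⟨0, by simp⟩, by simp⟩
  add_mem' := by
    rintro f g ⟨⟨C, hC⟩, hf⟩ ⟨⟨D, hD⟩, hg⟩
    refine ⟨⟨C + D, fun v => (abs_add_le _ _).trans (add_le_add (hC v) (hD v))⟩, fun v => ?_⟩
    simp only [Pi.add_apply, Finset.sum_add_distrib, hf v, hg v, mul_add]
  smul_mem' := by
    rintro c f ⟨⟨C, hC⟩, hf⟩
    refine ⟨⟨|c| * C, fun v => ?_⟩, fun v => ?_⟩
    · rw [Pi.smul_apply, smul_eq_mul, abs_mul]
      exact mul_le_mul_of_nonneg_left (hC v) (abs_nonneg c)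
    · simp only [Pi.smul_apply, smul_eq_mul, ← Finset.mul_sum, hf v]
      ring

end RootedGraph

namespace UnlabeledGraph

/-- The law of `(G, X₁)` given the class of `(G, ρ)`. -/
noncomputable def walkLaw : UnlabeledGraph → Measure UnlabeledGraph :=
  Quotient.lift RootedGraph.walkLaw fun _ _ h => RootedGraph.walkLaw_eq_of_iso h

/-- The law `μ` of a random rooted graph `(G, ρ)` is stationary if `(G, X₁)` has the same law, where
`X₁` is the simple random walk on `G` started from `ρ` after one step. -/
def IsStationary (μ : Measure UnlabeledGraph) : Prop :=
  ∀ A : Set UnlabeledGraph, MeasurableSet A → ∫⁻ x, x.walkLaw A ∂μ = μ A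

end UnlabeledGraph

/-! Write $P$ for averaging over one step of the walk (`avg`, `step`), $E_h$ for the mean square
increment of $h$, and $D(G,\rho)$ (`maxEnergy`) for the supremum of $E_h(\rho)$ over harmonic $h$
with $|h| \le 1$. Harmonicity gives $P h^2 = h^2 + E_h$, so $\sum_n P^n E_h \le \sup h^2$ and $P^n
E_h \to 0$. If the space of bounded harmonic functions is finite-dimensional, $D$ is at most a
constant times the sum of the energies of a basis, so $P^n D(\rho) \to 0$
(`tendsto_step_iterate_maxEnergy`).

Let $A$ be the event that $P^n D(\rho) \to 0$; moving the root along an edge preserves it. By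
stationarity $\mathbb{E}[1_A P^n D]$ is nondecreasing in $n$, and by dominated convergence ($D \le
4$) it tends to $0$, so it vanishes for every $n$ (`lintegral_indicator_vanishingEnergy`). Almost
surely on $A$, then, $P^n D(\rho) = 0$ for all $n$; hence $D$ is zero at every vertex and bounded
harmonic functions are constant (`rank_boundedHarmonic_eq_one`).

For measurability, $D$ is written as the infimum over $r$ of suprema that require harmonicity only
in the ball of radius $r$ and so depend on a finite ball; compactness of $[-1,1]^V$ shows that
nothing is lost (`exists_lt_energy`). -/

namespace RootedGraph

/-! ### The averaging operator of the walk. -/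

/-- The law of the simple random walk started from `v` after one step. -/
noncomputable def stepLaw (G : RootedGraph) (v : G.V) : PMF G.V :=
  (G.reroot v).walkStep

theorem stepLaw_of_nonempty {G : RootedGraph} {v : G.V} (hv : (G.nbrs v).Nonempty) :
    G.stepLaw v = PMF.uniformOfFinset (G.nbrs v) hv :=
  dif_pos hv

theorem stepLaw_of_empty {G : RootedGraph} {v : G.V} (hv : ¬ (G.nbrs v).Nonempty) :
    G.stepLaw v = PMF.pure v :=
  dif_neg hv

/-- The averaging operator of the simple random walk on `G`. -/
noncomputable def avg (G : RootedGraph) (g : G.V → ℝ≥0∞) (v : G.V) : ℝ≥0∞ :=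
  ∑' w : G.V, G.stepLaw v w * g w

theorem avg_of_nonempty {G : RootedGraph} {v : G.V} (hv : (G.nbrs v).Nonempty)
    (g : G.V → ℝ≥0∞) :
    G.avg g v = ((G.nbrs v).card : ℝ≥0∞)⁻¹ * ∑ w ∈ G.nbrs v, g w := by
  classical
  have hs : ∀ w : G.V, G.stepLaw v w =
      if w ∈ G.nbrs v then ((G.nbrs v).card : ℝ≥0∞)⁻¹ else 0 := by
    intro w
    rw [stepLaw_of_nonempty hv, PMF.uniformOfFinset_apply]
  rw [avg, tsum_eq_sum (s := G.nbrs v), Finset.mul_sum]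
  · exact Finset.sum_congr rfl fun w hw => by rw [hs, if_pos hw]
  · intro w hw
    rw [hs, if_neg hw, zero_mul]

theorem avg_of_empty {G : RootedGraph} {v : G.V} (hv : ¬ (G.nbrs v).Nonempty)
    (g : G.V → ℝ≥0∞) : G.avg g v = g v := by
  classical
  rw [avg, stepLaw_of_empty hv, tsum_eq_single v]
  · simp
  · intro w hw
    rw [PMF.pure_apply_of_ne _ _ hw, zero_mul]

theorem avg_mono (G : RootedGraph) : Monotone G.avg := fun _ _ h _ =>
  ENNReal.tsum_le_tsum fun w => mul_le_mul_right (h w) _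

theorem avg_add (G : RootedGraph) (f g : G.V → ℝ≥0∞) : G.avg (f + g) = G.avg f + G.avg g := by
  funext v
  simp only [avg, Pi.add_apply, mul_add, ENNReal.tsum_add]

theorem avg_const (G : RootedGraph) (c : ℝ≥0∞) : G.avg (fun _ => c) = fun _ => c := by
  funext v
  rw [avg, ENNReal.tsum_mul_right, PMF.tsum_coe, one_mul]

theorem avg_const_mul (G : RootedGraph) (c : ℝ≥0∞) (g : G.V → ℝ≥0∞) :
    G.avg (fun w => c * g w) = fun v => c * G.avg g v := by
  funext v
  simp only [avg, ← ENNReal.tsum_mul_left, mul_left_comm]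

theorem avg_sum (G : RootedGraph) {ι : Type*} (s : Finset ι) (g : ι → G.V → ℝ≥0∞) :
    G.avg (∑ i ∈ s, g i) = ∑ i ∈ s, G.avg (g i) := by
  classical
  induction s using Finset.induction_on with
  | empty => exact G.avg_const 0
  | insert a s ha ih => rw [Finset.sum_insert ha, Finset.sum_insert ha, avg_add, ih]

theorem tendsto_avg (G : RootedGraph) {ι : Type*} {l : Filter ι} {f : ι → G.V → ℝ≥0∞}
    {g : G.V → ℝ≥0∞} (h : ∀ v, Filter.Tendsto (fun i => f i v) l (nhds (g v))) (v : G.V) :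
    Filter.Tendsto (fun i => G.avg (f i) v) l (nhds (G.avg g v)) := by
  by_cases hv : (G.nbrs v).Nonempty
  · simp only [avg_of_nonempty hv]
    refine ENNReal.Tendsto.const_mul (tendsto_finsetSum _ fun w _ => h w) (Or.inr ?_)
    simpa using hv.ne_empty
  · simp only [avg_of_empty hv]
    exact h v

/-- An average is a finite sum with finite weights, hence continuous, so it commutes with decreasing
limits even where the values are infinite. -/
theorem avg_iInf (G : RootedGraph) {f : ℕ → G.V → ℝ≥0∞} (hf : Antitone f) :
    G.avg (fun w => ⨅ n, f n w) = fun v => ⨅ n, G.avg (f n) v := by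
  funext v
  refine tendsto_nhds_unique (G.tendsto_avg (fun w => tendsto_atTop_iInf fun m n h => hf h w) v)
    (tendsto_atTop_iInf fun m n h => G.avg_mono (hf h) v)

/-- A single neighbour carries weight one over the degree. This local Harnack bound transports both
zeros and decay along edges. -/
theorem le_avg_of_adj {G : RootedGraph} {v w : G.V} (h : G.graph.Adj v w) (g : G.V → ℝ≥0∞) :
    ((G.nbrs v).card : ℝ≥0∞)⁻¹ * g w ≤ G.avg g v := by
  have hw : w ∈ G.nbrs v := mem_nbrs.2 h
  rw [avg_of_nonempty ⟨w, hw⟩]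
  gcongr
  exact Finset.single_le_sum (f := g) (fun _ _ => zero_le) hw

/-- The one-step averaging operator, acting on functions of the rooted graph. -/
noncomputable def step (F : RootedGraph → ℝ≥0∞) (G : RootedGraph) : ℝ≥0∞ :=
  G.avg (fun v => F (G.reroot v)) G.root

theorem step_iterate_reroot (F : RootedGraph → ℝ≥0∞) (G : RootedGraph) (n : ℕ) :
    (fun v => step^[n] F (G.reroot v)) = G.avg^[n] fun v => F (G.reroot v) := by
  induction n with
  | zero => rfl
  | succ n ih =>
    rw [Function.iterate_succ_apply', Function.iterate_succ_apply', ← ih]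
    rfl

theorem step_mono : Monotone step := fun _ _ h G => G.avg_mono (fun _ => h _) _

theorem step_const (c : ℝ≥0∞) : step (fun _ => c) = fun _ => c := by
  funext G
  exact congrFun (G.avg_const c) _

theorem step_iInf {F : ℕ → RootedGraph → ℝ≥0∞} (hF : Antitone F) :
    step (fun G => ⨅ n, F n G) = fun G => ⨅ n, step (F n) G := by
  funext G
  exact congrFun (G.avg_iInf (f := fun n v => F n (G.reroot v)) fun m n h v => hF h _) _

theorem step_iterate_iInf {F : ℕ → RootedGraph → ℝ≥0∞} (hF : Antitone F) (k : ℕ) :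
    step^[k] (fun G => ⨅ n, F n G) = fun G => ⨅ n, step^[k] (F n) G := by
  induction k with
  | zero => rfl
  | succ k ih =>
    rw [Function.iterate_succ_apply', ih, step_iInf]
    · simp only [Function.iterate_succ_apply']
    · exact fun m n h => step_mono.iterate k (hF h)

/-! ### Partial isomorphisms -/

/-- The maps `f` and `g` restrict to mutually inverse isomorphisms between the subgraphs induced on
`S` and on `T`. -/
structure PartialIso (G H : RootedGraph) (S : Set G.V) (T : Set H.V) (f : G.V → H.V)
    (g : H.V → G.V) : Prop where
  mapsTo : Set.MapsTo f S T
  mapsTo_symm : Set.MapsTo g T S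
  left_inv : Set.LeftInvOn g f S
  right_inv : Set.LeftInvOn f g T
  adj : ∀ v ∈ S, ∀ w ∈ S, G.graph.Adj v w → H.graph.Adj (f v) (f w)
  adj_symm : ∀ v ∈ T, ∀ w ∈ T, H.graph.Adj v w → G.graph.Adj (g v) (g w)

namespace PartialIso

variable {G H : RootedGraph} {S : Set G.V} {T : Set H.V} {f : G.V → H.V} {g : H.V → G.V}

theorem symm (h : PartialIso G H S T f g) : PartialIso H G T S g f :=
  ⟨h.mapsTo_symm, h.mapsTo, h.right_inv, h.left_inv, h.adj_symm, h.adj⟩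

/-- A geodesic issuing from `w` stays within distance `n` of `w`, hence inside `S`, and is carried
edge by edge to a walk in `H`. -/
theorem dist_le (h : PartialIso G H S T f g) {w : G.V} {n : ℕ}
    (hw : ∀ v, G.graph.dist w v ≤ n → v ∈ S) {v : G.V} (hv : G.graph.dist w v ≤ n) :
    H.graph.dist (f w) (f v) ≤ n := by
  induction n generalizing v with
  | zero =>
    have : w = v := (G.connected w v).dist_eq_zero_iff.1 (Nat.le_zero.1 hv)
    simp [this]
  | succ n ih =>
    have ih' := fun {u} => ih (v := u) fun v hv => hw v (hv.trans n.le_succ)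
    rcases hv.lt_or_eq with hlt | heq
    · exact (ih' (Nat.lt_succ_iff.1 hlt)).trans n.le_succ
    · obtain ⟨p, hp⟩ := (G.connected v w).exists_walk_length_eq_dist
      rw [SimpleGraph.dist_comm, heq] at hp
      cases p with
      | nil => simp at hp
      -- `u` is the vertex before `v` on a geodesic from `w`.
      | @cons _ u _ hadj q =>
        have hu : G.graph.dist w u ≤ n := by
          rw [SimpleGraph.dist_comm]
          refine (SimpleGraph.dist_le q).trans ?_
          simpa using hp.le
        have hadj' := h.adj u (hw u (hu.trans n.le_succ)) v (hw v hv) hadj.symm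
        calc H.graph.dist (f w) (f v)
            ≤ H.graph.dist (f w) (f u) + H.graph.dist (f u) (f v) := H.connected.dist_triangle
          _ ≤ n + 1 := add_le_add (ih' hu) (SimpleGraph.dist_eq_one_iff_adj.2 hadj').le

theorem sum_nbrs (h : PartialIso G H S T f g) {M : Type*} [AddCommMonoid M] {v : G.V}
    (hv : v ∈ S) (hS : ∀ w ∈ G.nbrs v, w ∈ S) (hT : ∀ w ∈ H.nbrs (f v), w ∈ T)
    {a : G.V → M} {b : H.V → M} (hab : ∀ w ∈ S, a w = b (f w)) :
    ∑ w ∈ G.nbrs v, a w = ∑ w ∈ H.nbrs (f v), b w := by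
  refine Finset.sum_nbij' f g ?_ ?_ ?_ ?_ ?_
  · exact fun w hw => mem_nbrs.2 (h.adj v hv w (hS w hw) (mem_nbrs.1 hw))
  · intro w hw
    have := h.adj_symm _ (h.mapsTo hv) w (hT w hw) (mem_nbrs.1 hw)
    rw [h.left_inv hv] at this
    exact mem_nbrs.2 this
  · exact fun w hw => h.left_inv (hS w hw)
  · exact fun w hw => h.right_inv (hT w hw)
  · exact fun w hw => hab w (hS w hw)

theorem card_nbrs (h : PartialIso G H S T f g) {v : G.V}
    (hv : v ∈ S) (hS : ∀ w ∈ G.nbrs v, w ∈ S) (hT : ∀ w ∈ H.nbrs (f v), w ∈ T) :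
    (G.nbrs v).card = (H.nbrs (f v)).card := by
  simpa using h.sum_nbrs (M := ℕ) hv hS hT (a := fun _ => 1) (b := fun _ => 1) (by simp)

theorem avg_eq (h : PartialIso G H S T f g) {v : G.V}
    (hv : v ∈ S) (hS : ∀ w ∈ G.nbrs v, w ∈ S) (hT : ∀ w ∈ H.nbrs (f v), w ∈ T)
    {a : G.V → ℝ≥0∞} {b : H.V → ℝ≥0∞} (hab : ∀ w ∈ S, a w = b (f w)) :
    G.avg a v = H.avg b (f v) := by
  have hc := h.card_nbrs hv hS hT
  by_cases hn : (G.nbrs v).Nonempty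
  · have hn' : (H.nbrs (f v)).Nonempty := by rwa [← Finset.card_pos, ← hc, Finset.card_pos]
    rw [avg_of_nonempty hn, avg_of_nonempty hn', hc, h.sum_nbrs hv hS hT hab]
  · have hn' : ¬ (H.nbrs (f v)).Nonempty := by rwa [← Finset.card_pos, ← hc, Finset.card_pos]
    rw [avg_of_empty hn, avg_of_empty hn', hab v hv]

theorem restrict (h : PartialIso G H S T f g) {S' : Set G.V} {T' : Set H.V}
    (hS : S' ⊆ S) (hT : T' ⊆ T) (hf : Set.MapsTo f S' T') (hg : Set.MapsTo g T' S') :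
    PartialIso G H S' T' f g :=
  ⟨hf, hg, h.left_inv.mono hS, h.right_inv.mono hT, fun v hv w hw => h.adj v (hS hv) w (hS hw),
    fun v hv w hw => h.adj_symm v (hT hv) w (hT hw)⟩

theorem ballIso {r : ℕ} (h : PartialIso G H (G.ball r) (H.ball r) f g) (hf : f G.root = H.root) :
    G.BallIso r H := by
  refine ⟨⟨⟨fun v => ⟨f v, h.mapsTo v.2⟩, fun v => ⟨g v, h.mapsTo_symm v.2⟩,
    fun v => Subtype.ext (h.left_inv v.2), fun v => Subtype.ext (h.right_inv v.2)⟩, ?_⟩,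
    Subtype.ext hf⟩
  intro v w
  refine ⟨fun hvw => ?_, fun hvw => h.adj v v.2 w w.2 hvw⟩
  have := h.adj_symm _ (h.mapsTo v.2) _ (h.mapsTo w.2) hvw
  rw [h.left_inv v.2, h.left_inv w.2] at this
  exact this

end PartialIso

theorem BallIso.exists_partialIso {r : ℕ} {G H : RootedGraph} (h : G.BallIso r H) :
    ∃ f g, PartialIso G H (G.ball r) (H.ball r) f g ∧ f G.root = H.root := by
  classical
  obtain ⟨e, he⟩ := h
  -- The isomorphism of balls is extended to total maps, with the root as default value outside the
  -- ball.
  have hf : ∀ v (hv : v ∈ G.ball r), (fun v => if hv : v ∈ G.ball r then (e ⟨v, hv⟩ : H.V)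
      else H.root) v = e ⟨v, hv⟩ := fun v hv => dif_pos hv
  have hg : ∀ v (hv : v ∈ H.ball r), (fun v => if hv : v ∈ H.ball r then (e.symm ⟨v, hv⟩ : G.V)
      else G.root) v = e.symm ⟨v, hv⟩ := fun v hv => dif_pos hv
  generalize (fun v => if hv : v ∈ G.ball r then (e ⟨v, hv⟩ : H.V) else H.root) = f at hf
  generalize (fun v => if hv : v ∈ H.ball r then (e.symm ⟨v, hv⟩ : G.V) else G.root) = g at hg
  have hft : Set.MapsTo f (G.ball r) (H.ball r) := fun v hv => by rw [hf v hv]; exact Subtype.prop _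
  have hgt : Set.MapsTo g (H.ball r) (G.ball r) := fun v hv => by rw [hg v hv]; exact Subtype.prop _
  refine ⟨f, g, ⟨hft, hgt, ?_, ?_, ?_, ?_⟩, ?_⟩
  · intro v hv
    rw [hg _ (hft hv)]
    simp only [hf v hv, Subtype.coe_eta, RelIso.symm_apply_apply]
  · intro v hv
    rw [hf _ (hgt hv)]
    simp only [hg v hv, Subtype.coe_eta, RelIso.apply_symm_apply]
  · intro v hv w hw hvw
    rw [hf v hv, hf w hw]
    exact (e.map_adj_iff (v := ⟨v, hv⟩) (w := ⟨w, hw⟩)).2 hvw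
  · intro v hv w hw hvw
    rw [hg v hv, hg w hw]
    exact (e.symm.map_adj_iff (v := ⟨v, hv⟩) (w := ⟨w, hw⟩)).2 hvw
  · rw [hf _ (G.root_mem_ball r), he]

theorem BallIso.symm {r : ℕ} {G H : RootedGraph} (h : G.BallIso r H) : H.BallIso r G := by
  obtain ⟨e, he⟩ := h
  exact ⟨e.symm, by rw [← he, RelIso.symm_apply_apply]⟩

theorem Iso.ballIso {G H : RootedGraph} (h : G.Iso H) (r : ℕ) : G.BallIso r H := by
  obtain ⟨e, he⟩ := h
  have hp : PartialIso G H Set.univ Set.univ e e.symm :=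
    ⟨fun _ _ => trivial, fun _ _ => trivial, fun v _ => e.symm_apply_apply v,
      fun v _ => e.apply_symm_apply v, fun _ _ _ _ h => e.map_adj_iff.2 h,
      fun _ _ _ _ h => e.symm.map_adj_iff.2 h⟩
  refine PartialIso.ballIso (hp.restrict (Set.subset_univ _) (Set.subset_univ _) ?_ ?_) he
  · intro v hv
    have := hp.dist_le (fun _ _ => trivial) hv
    rwa [he] at this
  · intro v hv
    have := hp.symm.dist_le (fun _ _ => trivial) hv
    rwa [← he, e.symm_apply_apply] at this

theorem mem_ball_succ_of_adj {G : RootedGraph} {r : ℕ} {v w : G.V} (hv : v ∈ G.ball r)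
    (h : G.graph.Adj v w) : w ∈ G.ball (r + 1) :=
  G.connected.dist_triangle.trans (add_le_add hv (SimpleGraph.dist_eq_one_iff_adj.2 h).le)

theorem ball_mono (G : RootedGraph) : Monotone G.ball := fun _ _ h _ hv => le_trans hv h

theorem PartialIso.mapsTo_ball {G H : RootedGraph} {r s : ℕ} {f : G.V → H.V} {g : H.V → G.V}
    (h : PartialIso G H (G.ball r) (H.ball r) f g) (hf : f G.root = H.root) (hs : s ≤ r) :
    Set.MapsTo f (G.ball s) (H.ball s) := fun v hv => by
  have := h.dist_le (fun _ h => G.ball_mono hs h) hv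
  rwa [hf] at this

theorem PartialIso.symm_root {G H : RootedGraph} {r : ℕ} {f : G.V → H.V} {g : H.V → G.V}
    (h : PartialIso G H (G.ball r) (H.ball r) f g) (hf : f G.root = H.root) :
    g H.root = G.root := by
  rw [← hf, h.left_inv (G.root_mem_ball r)]

/-! ### Functions determined by a finite ball. -/

/-- A function of the rooted graph that depends only on the ball of radius `r`. -/
def IsLocal (r : ℕ) (F : RootedGraph → ℝ≥0∞) : Prop :=
  ∀ ⦃G H : RootedGraph⦄, G.BallIso r H → F G = F H

/-- Moving the root by at most one step costs one unit of radius, by the triangle inequality. -/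
theorem PartialIso.ballIso_reroot {G H : RootedGraph} {r : ℕ} {f : G.V → H.V} {g : H.V → G.V}
    (h : PartialIso G H (G.ball (r + 1)) (H.ball (r + 1)) f g) (hf : f G.root = H.root)
    {w : G.V} (hw : w ∈ G.ball 1) : (G.reroot w).BallIso r (H.reroot (f w)) := by
  have hw' : f w ∈ H.ball 1 := h.mapsTo_ball hf (by omega) hw
  have hS : (G.reroot w).ball r ⊆ G.ball (r + 1) := fun v hv => by
    have := G.connected.dist_triangle (u := G.root) (v := w) (w := v)
    have h1 : G.graph.dist G.root w ≤ 1 := hw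
    have h2 : G.graph.dist w v ≤ r := hv
    change G.graph.dist G.root v ≤ r + 1
    omega
  have hT : (H.reroot (f w)).ball r ⊆ H.ball (r + 1) := fun v hv => by
    have := H.connected.dist_triangle (u := H.root) (v := f w) (w := v)
    have h1 : H.graph.dist H.root (f w) ≤ 1 := hw'
    have h2 : H.graph.dist (f w) v ≤ r := hv
    change H.graph.dist H.root v ≤ r + 1
    omega
  have hp : PartialIso (G.reroot w) (H.reroot (f w)) (G.ball (r + 1)) (H.ball (r + 1)) f g :=
    ⟨h.mapsTo, h.mapsTo_symm, h.left_inv, h.right_inv, h.adj, h.adj_symm⟩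
  refine PartialIso.ballIso (hp.restrict hS hT ?_ ?_) rfl
  · exact fun v hv => h.dist_le (fun u hu => hS hu) hv
  · intro v hv
    have := h.symm.dist_le (fun u hu => hT hu) hv
    have hgf : g (f w) = w := h.left_inv (G.ball_mono (by omega) hw)
    change G.graph.dist (g (f w)) (g v) ≤ r at this
    rwa [hgf] at this

theorem IsLocal.step {r : ℕ} {F : RootedGraph → ℝ≥0∞} (hF : IsLocal r F) :
    IsLocal (r + 1) (step F) := by
  intro G H hGH
  obtain ⟨f, g, h, hf⟩ := hGH.exists_partialIso
  have h1 : PartialIso G H (G.ball 1) (H.ball 1) f g :=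
    h.restrict (G.ball_mono (by omega)) (H.ball_mono (by omega)) (h.mapsTo_ball hf (by omega))
      (h.symm.mapsTo_ball (h.symm_root hf) (by omega))
  rw [RootedGraph.step, RootedGraph.step, ← hf]
  refine h1.avg_eq (G.root_mem_ball _)
    (fun w hw => mem_ball_succ_of_adj (G.root_mem_ball 0) (mem_nbrs.1 hw))
    (fun w hw => mem_ball_succ_of_adj (H.root_mem_ball 0) (mem_nbrs.1 (hf ▸ hw)))
    fun w hw => hF (h.ballIso_reroot hf hw)

theorem IsLocal.step_iterate {r : ℕ} {F : RootedGraph → ℝ≥0∞} (hF : IsLocal r F) (n : ℕ) :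
    IsLocal (r + n) (RootedGraph.step^[n] F) := by
  induction n with
  | zero => exact hF
  | succ n ih =>
    rw [Function.iterate_succ_apply']
    exact ih.step

/-! ### Energy of bounded harmonic functions. -/

/-- The mean value property of `h` at the vertex `v`. -/
def HarmonicAt (G : RootedGraph) (h : G.V → ℝ) (v : G.V) : Prop :=
  ∑ w ∈ G.nbrs v, h w = ((G.nbrs v).card : ℝ) * h v

/-- The mean square increment of `h` along one step of the walk from `v`. -/
noncomputable def energy (G : RootedGraph) (h : G.V → ℝ) (v : G.V) : ℝ≥0∞ :=
  G.avg (fun w => ENNReal.ofReal ((h w - h v) ^ 2)) v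

/-- The second moment of `h` after one step is the squared mean plus the variance, and the mean is
`h v`. -/
theorem HarmonicAt.avg_sq {G : RootedGraph} {h : G.V → ℝ} {v : G.V} (hh : G.HarmonicAt h v) :
    G.avg (fun w => ENNReal.ofReal (h w ^ 2)) v = ENNReal.ofReal (h v ^ 2) + G.energy h v := by
  by_cases hv : (G.nbrs v).Nonempty
  · have hc : ((G.nbrs v).card : ℝ≥0∞) ≠ 0 := by simpa using hv.ne_empty
    have key : ∑ w ∈ G.nbrs v, h w ^ 2 =
        ((G.nbrs v).card : ℝ) * h v ^ 2 + ∑ w ∈ G.nbrs v, (h w - h v) ^ 2 := by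
      have h1 : ∑ w ∈ G.nbrs v, (h w - h v) ^ 2 = ∑ w ∈ G.nbrs v, h w ^ 2
          - 2 * h v * ∑ w ∈ G.nbrs v, h w + ((G.nbrs v).card : ℝ) * h v ^ 2 := by
        rw [Finset.mul_sum, ← Finset.sum_sub_distrib, ← nsmul_eq_mul, ← Finset.sum_const,
          ← Finset.sum_add_distrib]
        exact Finset.sum_congr rfl fun w _ => by ring
      have h2 : ∑ w ∈ G.nbrs v, h w = ((G.nbrs v).card : ℝ) * h v := hh
      rw [h1, h2]
      ring
    rw [energy, avg_of_nonempty hv, avg_of_nonempty hv,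
      ← ENNReal.ofReal_sum_of_nonneg (fun _ _ => sq_nonneg _),
      ← ENNReal.ofReal_sum_of_nonneg (fun _ _ => sq_nonneg _), key,
      ENNReal.ofReal_add (by positivity) (Finset.sum_nonneg fun _ _ => sq_nonneg _),
      ENNReal.ofReal_mul (by positivity), ENNReal.ofReal_natCast, mul_add, ← mul_assoc,
      ENNReal.inv_mul_cancel hc (ENNReal.natCast_ne_top _), one_mul]
  · rw [energy, avg_of_empty hv, avg_of_empty hv]
    simp

theorem avg_iterate_const_mul (G : RootedGraph) (c : ℝ≥0∞) (g : G.V → ℝ≥0∞) (n : ℕ) :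
    G.avg^[n] (fun w => c * g w) = fun v => c * G.avg^[n] g v := by
  induction n with
  | zero => rfl
  | succ n ih => rw [Function.iterate_succ_apply', ih, avg_const_mul, Function.iterate_succ_apply']

theorem avg_iterate_sum (G : RootedGraph) {ι : Type*} (s : Finset ι) (g : ι → G.V → ℝ≥0∞)
    (n : ℕ) : G.avg^[n] (∑ i ∈ s, g i) = ∑ i ∈ s, G.avg^[n] (g i) := by
  induction n with
  | zero => rfl
  | succ n ih => simp only [Function.iterate_succ_apply', ih, avg_sum]

theorem sum_avg_iterate_energy_le {G : RootedGraph} {h : G.V → ℝ} (hh : ∀ v, G.HarmonicAt h v)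
    {M : ℝ} (hM : ∀ v, |h v| ≤ M) (N : ℕ) (v : G.V) :
    ∑ n ∈ Finset.range N, G.avg^[n] (G.energy h) v ≤ ENNReal.ofReal (M ^ 2) := by
  have h1 : G.avg (fun w => ENNReal.ofReal (h w ^ 2)) =
      (fun w => ENNReal.ofReal (h w ^ 2)) + G.energy h := funext fun v => (hh v).avg_sq
  -- Each further averaging turns $h^2$ into $h^2 + E_h$ and shifts the existing sum by one index.
  have h2 : ∀ N : ℕ, G.avg^[N] (fun w => ENNReal.ofReal (h w ^ 2)) =
      (fun w => ENNReal.ofReal (h w ^ 2)) + ∑ n ∈ Finset.range N, G.avg^[n] (G.energy h) := by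
    intro N
    induction N with
    | zero => simp
    | succ N ih =>
      rw [Function.iterate_succ_apply', ih, avg_add, h1, avg_sum, Finset.sum_range_succ']
      simp only [Function.iterate_succ_apply', Function.iterate_zero, id_eq]
      rw [add_assoc, add_comm (G.energy h)]
  have h3 : G.avg^[N] (fun w => ENNReal.ofReal (h w ^ 2)) ≤ fun _ => ENNReal.ofReal (M ^ 2) := by
    induction N with
    | zero =>
      exact fun w => ENNReal.ofReal_le_ofReal (sq_le_sq' (abs_le.1 (hM w)).1 (abs_le.1 (hM w)).2)
    | succ N ih =>
      rw [Function.iterate_succ_apply', ← G.avg_const]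
      exact G.avg_mono ih
  have h4 := h3 v
  rw [h2] at h4
  simp only [Pi.add_apply, Finset.sum_apply] at h4
  exact le_add_self.trans h4

theorem tendsto_avg_iterate_energy {G : RootedGraph} {h : G.V → ℝ}
    (hh : ∀ v, G.HarmonicAt h v) {M : ℝ} (hM : ∀ v, |h v| ≤ M) (v : G.V) :
    Filter.Tendsto (fun n => G.avg^[n] (G.energy h) v) Filter.atTop (nhds 0) := by
  refine ENNReal.tendsto_atTop_zero_of_tsum_ne_top (ne_top_of_le_ne_top ENNReal.ofReal_ne_top
    (b := ENNReal.ofReal (M ^ 2)) ?_)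
  rw [ENNReal.tsum_eq_iSup_nat]
  exact iSup_le fun N => sum_avg_iterate_energy_le hh hM N v

/-! ### Domination by the energies of a basis. -/

/-- On a finite-dimensional space of functions, every functional is bounded in the sup norm. -/
theorem _root_.Submodule.exists_abs_dual_le {α : Type*} (W : Submodule ℝ (α → ℝ))
    [FiniteDimensional ℝ W] (φ : Module.Dual ℝ W) :
    ∃ C : ℝ, ∀ h : W, (∀ v, |(h : α → ℝ) v| ≤ 1) → |φ h| ≤ C := by
  let ev : α → Module.Dual ℝ W := fun v => (LinearMap.proj v).comp W.subtype
  -- The evaluations have no common zero but the zero function, so they span the finite-dimensional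
  -- dual; each is bounded by 1 on the sup-norm unit ball.
  have htop : Submodule.span ℝ (Set.range ev) = ⊤ := by
    have hbot : (Submodule.span ℝ (Set.range ev)).dualCoannihilator = ⊥ := by
      rw [eq_bot_iff]
      intro h hh
      rw [Submodule.mem_dualCoannihilator] at hh
      refine Subtype.ext (funext fun v => ?_)
      exact hh (ev v) (Submodule.subset_span ⟨v, rfl⟩)
    rw [← Subspace.dualCoannihilator_dualAnnihilator_eq (W := Submodule.span ℝ (Set.range ev)),
      hbot, Submodule.dualAnnihilator_bot]
  have hφ : φ ∈ Submodule.span ℝ (Set.range ev) := htop ▸ Submodule.mem_top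
  induction hφ using Submodule.span_induction with
  | mem x hx =>
    obtain ⟨v, rfl⟩ := hx
    exact ⟨1, fun h hh => hh v⟩
  | zero => exact ⟨0, fun h _ => by simp⟩
  | add x y _ _ hx hy =>
    obtain ⟨C, hC⟩ := hx
    obtain ⟨D, hD⟩ := hy
    exact ⟨C + D, fun h hh => (abs_add_le _ _).trans (add_le_add (hC h hh) (hD h hh))⟩
  | smul a x _ hx =>
    obtain ⟨C, hC⟩ := hx
    refine ⟨|a| * C, fun h hh => ?_⟩
    rw [LinearMap.smul_apply, smul_eq_mul, abs_mul]
    exact mul_le_mul_of_nonneg_left (hC h hh) (abs_nonneg a)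

/-- Cauchy–Schwarz applied to the increments of `h` in a basis; the coordinates are uniformly
bounded on the sup-norm unit ball. -/
theorem exists_energy_le (G : RootedGraph) [FiniteDimensional ℝ G.boundedHarmonic] :
    ∃ (C : ℝ≥0∞) (k : ℕ) (b : Fin k → G.boundedHarmonic), C ≠ ∞ ∧
      ∀ h : G.boundedHarmonic, (∀ v, |(h : G.V → ℝ) v| ≤ 1) →
        ∀ v, G.energy h v ≤ C * ∑ i, G.energy (b i) v := by
  let b := Module.finBasis ℝ G.boundedHarmonic
  choose C hC using fun i => G.boundedHarmonic.exists_abs_dual_le (b.coord i)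
  refine ⟨ENNReal.ofReal (∑ i, C i ^ 2), _, b, ENNReal.ofReal_ne_top, fun h hh v => ?_⟩
  have hsum : ∀ w, (h : G.V → ℝ) w = ∑ i, b.coord i h * (b i : G.V → ℝ) w := by
    intro w
    conv_lhs => rw [← b.sum_repr h]
    simp only [Submodule.coe_sum, Finset.sum_apply, Submodule.coe_smul, Pi.smul_apply, smul_eq_mul,
      Module.Basis.coord_apply]
  have hE : ∑ i, G.energy (b i) v =
      G.avg (∑ i, fun w => ENNReal.ofReal (((b i : G.V → ℝ) w - (b i : G.V → ℝ) v) ^ 2)) v := by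
    rw [avg_sum, Finset.sum_apply]
    rfl
  rw [hE, ← congrFun (G.avg_const_mul _ _) v]
  refine G.avg_mono (fun w => ?_) v
  rw [Finset.sum_apply, ← ENNReal.ofReal_sum_of_nonneg (fun _ _ => sq_nonneg _),
    ← ENNReal.ofReal_mul (Finset.sum_nonneg fun _ _ => sq_nonneg _)]
  refine ENNReal.ofReal_le_ofReal ?_
  have hd : (h : G.V → ℝ) w - (h : G.V → ℝ) v =
      ∑ i, b.coord i h * ((b i : G.V → ℝ) w - (b i : G.V → ℝ) v) := by
    rw [hsum w, hsum v, ← Finset.sum_sub_distrib]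
    exact Finset.sum_congr rfl fun i _ => by ring
  rw [hd]
  refine (Finset.sum_mul_sq_le_sq_mul_sq _ _ _).trans ?_
  refine mul_le_mul_of_nonneg_right (Finset.sum_le_sum fun i _ => ?_)
    (Finset.sum_nonneg fun _ _ => sq_nonneg _)
  exact sq_le_sq' (abs_le.1 (hC i h hh)).1 (abs_le.1 (hC i h hh)).2

/-! ### The maximal energy and its local approximations. -/

/-- The largest energy at the root among the functions with values in `[-1, 1]` that are harmonic
in the ball of radius `r`. -/
noncomputable def ballEnergy (r : ℕ) (G : RootedGraph) : ℝ≥0∞ :=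
  ⨆ h : {h : G.V → ℝ // (∀ v, |h v| ≤ 1) ∧ ∀ v ∈ G.ball r, G.HarmonicAt h v}, G.energy h G.root

theorem ballEnergy_antitone : Antitone ballEnergy := fun _ _ h G => iSup_le fun f =>
  le_iSup_of_le ⟨f.1, f.2.1, fun v hv => f.2.2 v (G.ball_mono h hv)⟩ le_rfl

/-- The radius is `r + 1` because harmonicity on the ball of radius `r` involves neighbours one step
further out. -/
theorem ballEnergy_le_of_ballIso {r : ℕ} {G H : RootedGraph} (hGH : G.BallIso (r + 1) H) :
    ballEnergy r G ≤ ballEnergy r H := by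
  classical
  obtain ⟨f, g, hfg, hf⟩ := hGH.exists_partialIso
  have hg := hfg.symm_root hf
  refine iSup_le fun ⟨h, hb, hh⟩ => ?_
  -- The transported function is set to 0 off the larger ball: the bound survives, and the mean
  -- value property in radius `r` never sees those values.
  have hval : ∀ w ∈ H.ball (r + 1), h (g w) =
      (fun w => if w ∈ H.ball (r + 1) then h (g w) else 0) w := fun w hw => (if_pos hw).symm
  have hbd : ∀ w, |(fun w => if w ∈ H.ball (r + 1) then h (g w) else 0) w| ≤ 1 := by
    intro w
    dsimp only
    split_ifs
    · exact hb _
    · simp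
  generalize (fun w => if w ∈ H.ball (r + 1) then h (g w) else 0) = h' at hval hbd
  have hval' : ∀ w ∈ G.ball (r + 1), h w = h' (f w) := fun w hw => by
    rw [← hval _ (hfg.mapsTo hw), hfg.left_inv hw]
  refine le_iSup_of_le ⟨h', hbd, fun v hv => ?_⟩ (le_of_eq ?_)
  · have hv' := H.ball_mono (Nat.le_add_right r 1) hv
    have hgv : g v ∈ G.ball r := hfg.symm.mapsTo_ball hg (by omega) hv
    have hS : ∀ w ∈ H.nbrs v, w ∈ H.ball (r + 1) :=
      fun w hw => mem_ball_succ_of_adj hv (mem_nbrs.1 hw)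
    have hT : ∀ w ∈ G.nbrs (g v), w ∈ G.ball (r + 1) :=
      fun w hw => mem_ball_succ_of_adj hgv (mem_nbrs.1 hw)
    rw [HarmonicAt, hfg.symm.sum_nbrs hv' hS hT (fun w hw => (hval w hw).symm),
      hfg.symm.card_nbrs hv' hS hT, ← hval v hv']
    exact hh _ hgv
  · have hS : ∀ w ∈ G.nbrs G.root, w ∈ G.ball (r + 1) := fun w hw =>
      G.ball_mono (by omega) (mem_ball_succ_of_adj (G.root_mem_ball 0) (mem_nbrs.1 hw))
    have hT : ∀ w ∈ H.nbrs (f G.root), w ∈ H.ball (r + 1) := fun w hw =>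
      H.ball_mono (by omega) (mem_ball_succ_of_adj (H.root_mem_ball 0) (mem_nbrs.1 (hf ▸ hw)))
    change G.energy h G.root = H.energy h' H.root
    rw [energy, energy, ← hf]
    refine hfg.avg_eq (G.root_mem_ball _) hS hT fun w hw => ?_
    rw [hval' w hw, hval' _ (G.root_mem_ball _)]

theorem isLocal_ballEnergy (r : ℕ) : IsLocal (r + 1) (ballEnergy r) := fun _ _ h =>
  le_antisymm (ballEnergy_le_of_ballIso h) (ballEnergy_le_of_ballIso h.symm)

theorem energy_le_four {G : RootedGraph} {h : G.V → ℝ} (hb : ∀ v, |h v| ≤ 1) (v : G.V) :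
    G.energy h v ≤ 4 := by
  refine (G.avg_mono (b := fun _ => 4) (fun w => ?_) v).trans (congrFun (G.avg_const 4) v).le
  rw [show (4 : ℝ≥0∞) = ENNReal.ofReal 4 by simp]
  refine ENNReal.ofReal_le_ofReal ?_
  have h1 := abs_le.1 (hb v)
  have h2 := abs_le.1 (hb w)
  nlinarith [h1.1, h1.2, h2.1, h2.2]

/-- The largest energy at the root among the harmonic functions with values in `[-1, 1]`, expressed
through local functions of the rooted graph. -/
noncomputable def maxEnergy (G : RootedGraph) : ℝ≥0∞ := ⨅ r, ballEnergy r G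

theorem maxEnergy_le_four (G : RootedGraph) : maxEnergy G ≤ 4 :=
  (iInf_le _ 0).trans (iSup_le fun h => energy_le_four h.2.1 _)

theorem energy_le_maxEnergy {G : RootedGraph} {h : G.V → ℝ} (hb : ∀ v, |h v| ≤ 1)
    (hh : ∀ v, G.HarmonicAt h v) (v : G.V) : G.energy h v ≤ maxEnergy (G.reroot v) :=
  le_iInf fun _ => le_iSup_of_le ⟨h, hb, fun w _ => hh w⟩ le_rfl

theorem tendsto_energy {G : RootedGraph} {ι : Type*} {l : Filter ι} {f : ι → G.V → ℝ}
    {h : G.V → ℝ} (hf : Filter.Tendsto f l (nhds h)) (v : G.V) :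
    Filter.Tendsto (fun i => G.energy (f i) v) l (nhds (G.energy h v)) := by
  rw [tendsto_pi_nhds] at hf
  exact G.tendsto_avg
    (f := fun i w => ENNReal.ofReal ((f i w - f i v) ^ 2))
    (fun w => ENNReal.tendsto_ofReal (((hf w).sub (hf v)).pow 2)) v

/-- Near-maximizers for growing radii have a cluster point in the compact cube $[-1,1]^V$.
Harmonicity and energy at a vertex involve finitely many coordinates, so both pass to the limit. -/
theorem exists_lt_energy {G : RootedGraph} {c : ℝ≥0∞} (hc : c < maxEnergy G) :
    ∃ h : G.V → ℝ, (∀ v, |h v| ≤ 1) ∧ (∀ v, G.HarmonicAt h v) ∧ c ≤ G.energy h G.root := by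
  have hr : ∀ r, ∃ h : G.V → ℝ, ((∀ v, |h v| ≤ 1) ∧ ∀ v ∈ G.ball r, G.HarmonicAt h v) ∧
      c < G.energy h G.root := fun r => by
    obtain ⟨⟨h, hh⟩, hlt⟩ := lt_iSup_iff.1 (hc.trans_le (iInf_le _ r))
    exact ⟨h, hh, hlt⟩
  choose f hf hlt using hr
  let U : Ultrafilter ℕ := Filter.hyperfilter ℕ
  have hK : IsCompact (Set.univ.pi fun _ : G.V => Set.Icc (-1 : ℝ) 1) :=
    isCompact_univ_pi fun _ => isCompact_Icc
  obtain ⟨h, hhK, hle⟩ := hK.ultrafilter_le_nhds (U.map f) (by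
    rw [Filter.le_principal_iff]
    exact Filter.mem_map.2 (Filter.univ_mem' fun r v _ => abs_le.1 ((hf r).1 v)))
  have hlim : Filter.Tendsto f U (nhds h) := hle
  have hU : (U : Filter ℕ) ≤ Filter.atTop := by
    rw [← Nat.cofinite_eq_atTop]
    exact Filter.hyperfilter_le_cofinite
  refine ⟨h, fun v => abs_le.2 (hhK v trivial), fun v => ?_, ?_⟩
  · have hlim' := tendsto_pi_nhds.1 hlim
    have h1 : Filter.Tendsto (fun r => ∑ w ∈ G.nbrs v, f r w) U (nhds (∑ w ∈ G.nbrs v, h w)) :=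
      tendsto_finsetSum _ fun w _ => hlim' w
    have h2 : Filter.Tendsto (fun r => ((G.nbrs v).card : ℝ) * f r v) U
        (nhds (((G.nbrs v).card : ℝ) * h v)) := (hlim' v).const_mul _
    refine tendsto_nhds_unique_of_eventuallyEq h1 h2 (hU ?_)
    -- `f r` is harmonic at `v` as soon as the ball of radius `r` contains `v`.
    filter_upwards [Filter.eventually_ge_atTop (G.graph.dist G.root v)] with r hr
    exact (hf r).2 v hr
  · exact ge_of_tendsto (tendsto_energy hlim G.root) (Filter.Eventually.of_forall fun r => (hlt r).le)

/-! ### Decay in finite dimension, and rigidity when the energy vanishes. -/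

theorem tendsto_step_iterate_maxEnergy (G : RootedGraph)
    [FiniteDimensional ℝ G.boundedHarmonic] :
    Filter.Tendsto (fun n => step^[n] maxEnergy G) Filter.atTop (nhds 0) := by
  obtain ⟨C, k, b, hC, hle⟩ := G.exists_energy_le
  have hmax : (fun v => maxEnergy (G.reroot v)) ≤
      fun v => C * (∑ i, G.energy (b i) : G.V → ℝ≥0∞) v := by
    intro v
    refine le_of_forall_lt fun c hc => ?_
    -- The intermediate value restores the strict inequality, since the limit function only has
    -- energy at least `c'`.
    obtain ⟨c', hcc', hc'⟩ := exists_between hc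
    obtain ⟨h, hb, hh, hlt⟩ := exists_lt_energy hc'
    refine hcc'.trans_le (hlt.trans ((hle ⟨h, ⟨1, hb⟩, hh⟩ hb v).trans_eq ?_))
    simp only [Finset.sum_apply]
  have hiter : ∀ n, step^[n] maxEnergy G ≤ C * ∑ i, G.avg^[n] (G.energy (b i)) G.root := by
    intro n
    have h1 := G.avg_mono.iterate n hmax G.root
    rw [← step_iterate_reroot, avg_iterate_const_mul, avg_iterate_sum] at h1
    simp only [Finset.sum_apply] at h1
    exact h1
  refine tendsto_of_tendsto_of_tendsto_of_le_of_le tendsto_const_nhds ?_ (fun _ => zero_le) hiter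
  have h0 : Filter.Tendsto (fun n => C * ∑ i, G.avg^[n] (G.energy (b i)) G.root) Filter.atTop
      (nhds (C * ∑ _i : Fin k, 0)) := by
    refine ENNReal.Tendsto.const_mul (tendsto_finsetSum _ fun i _ => ?_) (Or.inr hC)
    obtain ⟨⟨M, hM⟩, hh⟩ := (b i).2
    exact tendsto_avg_iterate_energy hh hM _
  simpa using h0

theorem eq_of_energy_eq_zero {G : RootedGraph} {h : G.V → ℝ} {v w : G.V}
    (hv : G.energy h v = 0) (hvw : G.graph.Adj v w) : h w = h v := by
  have h1 := le_avg_of_adj hvw fun w => ENNReal.ofReal ((h w - h v) ^ 2)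
  rw [← energy, hv, nonpos_iff_eq_zero, mul_eq_zero] at h1
  rcases h1 with h1 | h1
  · simp at h1
  · have h2 := ENNReal.ofReal_eq_zero.1 h1
    nlinarith [sq_nonneg (h w - h v), pow_eq_zero_iff (two_ne_zero) |>.1
      (le_antisymm h2 (sq_nonneg (h w - h v)))]

/-- A function of the rooted graph whose iterated averages vanish at the root vanishes at every
vertex. -/
theorem eq_zero_of_step_iterate_eq_zero {F : RootedGraph → ℝ≥0∞} {G : RootedGraph}
    (h : ∀ n, step^[n] F G = 0) (v : G.V) : F (G.reroot v) = 0 := by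
  have key : ∀ u w : G.V, G.graph.Walk u w → (∀ n, step^[n] F (G.reroot u) = 0) →
      ∀ n, step^[n] F (G.reroot w) = 0 := by
    intro u w p
    induction p with
    | nil => exact id
    | @cons u x w hadj p ih =>
      refine fun hu => ih fun n => ?_
      -- One more iterate at `u` averages the `n`-th iterate over the neighbours of `u`, so the
      -- latter is zero at each of them.
      have h1 := hu (n + 1)
      rw [Function.iterate_succ_apply'] at h1
      have h2 := le_avg_of_adj hadj fun w => step^[n] F (G.reroot w)
      have h3 : G.avg (fun w => step^[n] F (G.reroot w)) u = 0 := h1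
      rw [h3, nonpos_iff_eq_zero, mul_eq_zero] at h2
      exact h2.resolve_left (by simp)
  obtain ⟨p⟩ := G.connected G.root v
  exact key _ _ p h 0

theorem rank_boundedHarmonic_eq_one {G : RootedGraph} (h : ∀ n, step^[n] maxEnergy G = 0) :
    Module.rank ℝ G.boundedHarmonic = 1 := by
  have hconst : ∀ f : G.V → ℝ, (∀ v, |f v| ≤ 1) → (∀ v, G.HarmonicAt f v) →
      ∀ v, f v = f G.root := by
    intro f hb hf v
    have hadj : ∀ u w, G.graph.Adj u w → f w = f u := fun u w => eq_of_energy_eq_zero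
      (le_antisymm ((energy_le_maxEnergy hb hf u).trans_eq (eq_zero_of_step_iterate_eq_zero h u))
        zero_le)
    have key : ∀ u w : G.V, G.graph.Walk u w → f u = f w := fun u w p => by
      induction p with
      | nil => rfl
      | cons hvw _ ih => rw [← hadj _ _ hvw, ih]
    obtain ⟨p⟩ := G.connected v G.root
    exact key _ _ p
  have hone : (fun _ => 1 : G.V → ℝ) ∈ G.boundedHarmonic := ⟨⟨1, by simp⟩, by simp⟩
  rw [rank_eq_one_iff]
  refine ⟨⟨_, hone⟩, fun h0 => ?_, fun f => ⟨(f : G.V → ℝ) G.root, Subtype.ext (funext fun v => ?_)⟩⟩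
  · have := congrFun (congrArg Subtype.val h0) G.root
    simp at this
  · obtain ⟨f, ⟨C, hC⟩, hf⟩ := f
    -- Scaling by the inverse of `|C| + 1` brings `f` into $[-1,1]$; the added 1 avoids dividing by
    -- zero.
    have hCpos : 0 < |C| + 1 := by positivity
    have hg := G.boundedHarmonic.smul_mem (|C| + 1)⁻¹ (show f ∈ G.boundedHarmonic from ⟨⟨C, hC⟩, hf⟩)
    have := hconst ((|C| + 1)⁻¹ • f) (fun w => ?_) hg.2 v
    · simp only [Pi.smul_apply, smul_eq_mul] at this
      have h2 := mul_left_cancel₀ (inv_ne_zero hCpos.ne') this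
      simp [h2]
    · rw [Pi.smul_apply, smul_eq_mul, abs_mul, abs_of_pos (inv_pos.2 hCpos), inv_mul_le_iff₀ hCpos]
      linarith [hC w, le_abs_self C]

/-! ### Measurability on isomorphism classes. -/

theorem finite_ball (G : RootedGraph) (r : ℕ) : (G.ball r).Finite := by
  induction r with
  | zero =>
    refine (Set.finite_singleton G.root).subset fun v hv => ?_
    exact ((G.connected G.root v).dist_eq_zero_iff.1 (Nat.le_zero.1 hv)).symm
  | succ r ih =>
    refine (ih.union (ih.biUnion fun v _ => G.locallyFinite v)).subset fun v hv => ?_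
    rcases (show G.graph.dist G.root v ≤ r + 1 from hv).lt_or_eq with hlt | heq
    · exact Or.inl (Nat.lt_succ_iff.1 hlt)
    · obtain ⟨p, hp⟩ := (G.connected v G.root).exists_walk_length_eq_dist
      rw [SimpleGraph.dist_comm, heq] at hp
      cases p with
      | nil => simp at hp
      | @cons _ u _ hadj q =>
        refine Or.inr (Set.mem_biUnion (x := u) ?_ hadj.symm)
        change G.graph.dist G.root u ≤ r
        rw [SimpleGraph.dist_comm]
        refine (SimpleGraph.dist_le q).trans ?_
        simpa using hp.le

/-- There are only countably many rooted balls up to isomorphism. -/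
theorem exists_ball_code (r : ℕ) :
    ∃ c : RootedGraph → Σ n : ℕ, SimpleGraph (Fin n) × Fin n,
      ∀ G H, c G = c H → G.BallIso r H := by
  have hex : ∀ G : RootedGraph, ∃ (c : Σ n : ℕ, SimpleGraph (Fin n) × Fin n)
      (e : G.graph.induce (G.ball r) ≃g c.2.1), e ⟨G.root, G.root_mem_ball r⟩ = c.2.2 := by
    intro G
    obtain ⟨n, ⟨e⟩⟩ := (G.finite_ball r).exists_equiv_fin
    exact ⟨⟨n, (G.graph.induce (G.ball r)).map e.toEmbedding, e ⟨G.root, G.root_mem_ball r⟩⟩,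
      SimpleGraph.Iso.map e _, rfl⟩
  choose c e he using hex
  refine ⟨c, fun G H hGH => ?_⟩
  -- The codes are generalized so that their equality can be substituted in the types of the two
  -- isomorphisms.
  have key : ∀ (d d' : Σ n : ℕ, SimpleGraph (Fin n) × Fin n) (_ : d = d')
      (e : G.graph.induce (G.ball r) ≃g d.2.1) (e' : H.graph.induce (H.ball r) ≃g d'.2.1),
      e ⟨G.root, G.root_mem_ball r⟩ = d.2.2 → e' ⟨H.root, H.root_mem_ball r⟩ = d'.2.2 →
        G.BallIso r H := by
    rintro d _ rfl e e' he he'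
    exact ⟨e.trans e'.symm, by
      rw [RelIso.trans_apply, he, ← he', RelIso.symm_apply_apply]⟩
  exact key _ _ hGH (e G) (e H) (he G) (he H)

/-- A function of the rooted graph, viewed as a function on isomorphism classes through the choice
of a representative. -/
noncomputable def onClass (F : RootedGraph → ℝ≥0∞) (x : UnlabeledGraph) : ℝ≥0∞ := F (Quotient.out x)

theorem out_iso (G : RootedGraph) : (Quotient.out G.toUnlabeled).Iso G :=
  Quotient.exact (Quotient.out_eq G.toUnlabeled)

theorem IsLocal.onClass_toUnlabeled {r : ℕ} {F : RootedGraph → ℝ≥0∞} (hF : IsLocal r F)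
    (G : RootedGraph) : onClass F G.toUnlabeled = F G :=
  hF (G.out_iso.ballIso r)

/-- There are countably many ball types, so every preimage is a countable union of generators of the
σ-algebra. -/
theorem IsLocal.measurable {r : ℕ} {F : RootedGraph → ℝ≥0∞} (hF : IsLocal r F) :
    Measurable (onClass F) := by
  intro s _
  obtain ⟨c, hc⟩ := exists_ball_code r
  have hrep : ∀ d : Set.range c, ∃ G, c G = d := fun d => d.2
  choose H hH using hrep
  have : onClass F ⁻¹' s = ⋃ d ∈ {d : Set.range c | F (H d) ∈ s},
      {x | ∃ G : RootedGraph, G.toUnlabeled = x ∧ G.BallIso r (H d)} := by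
    ext x
    simp only [Set.mem_preimage, Set.mem_iUnion, exists_prop, Set.mem_ofPred_eq]
    constructor
    · intro hx
      have hiso := hc (Quotient.out x) (H ⟨c (Quotient.out x), _, rfl⟩) (hH ⟨_, _, rfl⟩).symm
      exact ⟨⟨c (Quotient.out x), _, rfl⟩, by rw [← hF hiso]; exact hx, _, Quotient.out_eq x, hiso⟩
    · rintro ⟨d, hd, G, rfl, hG⟩
      rwa [hF.onClass_toUnlabeled, hF hG]
  rw [this]
  exact MeasurableSet.biUnion (Set.to_countable _) fun d _ =>
    MeasurableSpace.measurableSet_generateFrom ⟨r, H d, rfl⟩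

theorem lintegral_toMeasure {α : Type*} [MeasurableSpace α] (p : PMF α) {f : α → ℝ≥0∞}
    (hf : Measurable f) : ∫⁻ x, f x ∂p.toMeasure = ∑' x, p x * f x := by
  have : p.toMeasure = Measure.sum fun x => p x • Measure.dirac x := by
    ext s hs
    rw [PMF.toMeasure_apply _ hs, Measure.sum_apply _ hs]
    refine tsum_congr fun x => ?_
    rw [Measure.smul_apply, Measure.dirac_apply' _ hs, smul_eq_mul]
    by_cases hx : x ∈ s <;> simp [hx]
  rw [this, lintegral_sum_measure]
  refine tsum_congr fun x => ?_
  rw [lintegral_smul_measure, lintegral_dirac' _ hf, smul_eq_mul]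

theorem lintegral_walkLaw (G : RootedGraph) {f : UnlabeledGraph → ℝ≥0∞} (hf : Measurable f) :
    ∫⁻ y, f y ∂UnlabeledGraph.walkLaw G.toUnlabeled =
      G.avg (fun v => f (G.reroot v).toUnlabeled) G.root := by
  let _ : MeasurableSpace G.V := ⊤
  have hφ : Measurable fun v : G.V => (G.reroot v).toUnlabeled := fun _ _ => trivial
  have hmap := PMF.toMeasure_map _ G.walkStep hφ
  change ∫⁻ y, f y ∂(G.walkStep.map fun v => (G.reroot v).toUnlabeled).toMeasure = _
  rw [← hmap, lintegral_map hf hφ]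
  exact lintegral_toMeasure _ (hf.comp hφ)

/-! ### Stationarity and the vanishing event. -/

/-- Stationarity is applied to the level sets of simple functions below `f`. Only an inequality is
sought, so superadditivity of the lower integral suffices and measurability of `walkLaw` in its base
point is not needed. -/
theorem lintegral_le_lintegral_walkLaw {μ : Measure UnlabeledGraph}
    (hμ : UnlabeledGraph.IsStationary μ) (f : UnlabeledGraph → ℝ≥0∞) :
    ∫⁻ x, f x ∂μ ≤ ∫⁻ x, ∫⁻ y, f y ∂x.walkLaw ∂μ := by
  have hsum : ∀ (s : Finset ℝ≥0∞) (g : ℝ≥0∞ → UnlabeledGraph → ℝ≥0∞),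
      ∑ c ∈ s, ∫⁻ x, g c x ∂μ ≤ ∫⁻ x, ∑ c ∈ s, g c x ∂μ := by
    classical
    intro s g
    induction s using Finset.induction_on with
    | empty => simp
    | insert a s ha ih =>
      simp only [Finset.sum_insert ha]
      exact (add_le_add_right ih _).trans (le_lintegral_add _ _)
  conv_lhs => rw [lintegral]
  refine iSup₂_le fun g hg => ?_
  calc g.lintegral μ = ∑ c ∈ g.range, c * ∫⁻ x, x.walkLaw (g ⁻¹' {c}) ∂μ :=
        Finset.sum_congr rfl fun c _ => by rw [hμ _ (g.measurableSet_preimage _)]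
    _ ≤ ∑ c ∈ g.range, ∫⁻ x, c * x.walkLaw (g ⁻¹' {c}) ∂μ :=
        Finset.sum_le_sum fun c _ => lintegral_const_mul_le _ _
    _ ≤ ∫⁻ x, ∑ c ∈ g.range, c * x.walkLaw (g ⁻¹' {c}) ∂μ := hsum _ _
    _ ≤ ∫⁻ x, ∫⁻ y, f y ∂x.walkLaw ∂μ := lintegral_mono fun x => by
        refine le_trans (le_of_eq ?_) (lintegral_mono hg)
        rw [SimpleFunc.lintegral_eq_lintegral]
        rfl

theorem step_iterate_maxEnergy_eq (n : ℕ) :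
    step^[n] maxEnergy = fun G => ⨅ r, step^[n] (ballEnergy r) G :=
  step_iterate_iInf ballEnergy_antitone n

theorem onClass_step_iterate_maxEnergy (n : ℕ) (G : RootedGraph) :
    onClass (step^[n] maxEnergy) G.toUnlabeled = step^[n] maxEnergy G := by
  rw [step_iterate_maxEnergy_eq]
  exact iInf_congr fun r => ((isLocal_ballEnergy r).step_iterate n).onClass_toUnlabeled G

theorem measurable_onClass_step_iterate_maxEnergy (n : ℕ) :
    Measurable (onClass (step^[n] maxEnergy)) := by
  rw [step_iterate_maxEnergy_eq]
  exact Measurable.iInf fun r => ((isLocal_ballEnergy r).step_iterate n).measurable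

theorem step_iterate_maxEnergy_le_four (n : ℕ) (G : RootedGraph) : step^[n] maxEnergy G ≤ 4 := by
  induction n generalizing G with
  | zero => exact maxEnergy_le_four G
  | succ n ih =>
    rw [Function.iterate_succ_apply']
    exact (step_mono (b := fun _ => 4) ih G).trans_eq (congrFun (step_const 4) G)

/-- The rooted graphs on which the iterated averages of the maximal energy tend to zero. -/
def vanishingEnergy : Set UnlabeledGraph :=
  {x | Filter.Tendsto (fun n => onClass (step^[n] maxEnergy) x) Filter.atTop (nhds 0)}

theorem measurableSet_vanishingEnergy : MeasurableSet vanishingEnergy :=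
  measurableSet_tendsto _ measurable_onClass_step_iterate_maxEnergy

theorem mem_vanishingEnergy {G : RootedGraph} : G.toUnlabeled ∈ vanishingEnergy ↔
    Filter.Tendsto (fun n => step^[n] maxEnergy G) Filter.atTop (nhds 0) := by
  simp only [vanishingEnergy, Set.mem_ofPred_eq, onClass_step_iterate_maxEnergy]

/-- One step from `v` reaches the old root with probability one over the degree of `v`, so the
`n`-th iterate there is at most that degree times the iterate `n + 1` at `v`. -/
theorem mem_vanishingEnergy_of_adj {G : RootedGraph} {v : G.V} (hv : G.graph.Adj G.root v)
    (h : (G.reroot v).toUnlabeled ∈ vanishingEnergy) : G.toUnlabeled ∈ vanishingEnergy := by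
  rw [mem_vanishingEnergy] at h ⊢
  have hc : ((G.nbrs v).card : ℝ≥0∞) ≠ 0 := by
    simpa using Finset.ne_empty_of_mem (mem_nbrs.2 hv.symm)
  have hle : ∀ n, step^[n] maxEnergy G ≤
      ((G.nbrs v).card : ℝ≥0∞) * step^[n + 1] maxEnergy (G.reroot v) := by
    intro n
    have h1 := le_avg_of_adj hv.symm fun w => step^[n] maxEnergy (G.reroot w)
    rw [ENNReal.inv_mul_le_iff hc (ENNReal.natCast_ne_top _)] at h1
    rw [Function.iterate_succ_apply']
    exact h1
  refine tendsto_of_tendsto_of_tendsto_of_le_of_le tendsto_const_nhds ?_ (fun _ => zero_le) hle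
  have := ENNReal.Tendsto.const_mul (a := ((G.nbrs v).card : ℝ≥0∞))
    ((Filter.tendsto_add_atTop_iff_nat 1).2 h) (Or.inr (ENNReal.natCast_ne_top _))
  simpa using this

theorem lintegral_indicator_vanishingEnergy_le {μ : Measure UnlabeledGraph}
    (hμ : UnlabeledGraph.IsStationary μ) (n : ℕ) :
    ∫⁻ x, vanishingEnergy.indicator (onClass (step^[n] maxEnergy)) x ∂μ ≤
      ∫⁻ x, vanishingEnergy.indicator (onClass (step^[n + 1] maxEnergy)) x ∂μ := by
  refine (lintegral_le_lintegral_walkLaw hμ _).trans (lintegral_mono fun x => ?_)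
  obtain ⟨G, rfl⟩ := Quotient.exists_rep x
  change ∫⁻ y, _ ∂UnlabeledGraph.walkLaw G.toUnlabeled ≤
    vanishingEnergy.indicator (onClass (step^[n + 1] maxEnergy)) G.toUnlabeled
  rw [lintegral_walkLaw G ((measurable_onClass_step_iterate_maxEnergy n).indicator
    measurableSet_vanishingEnergy)]
  by_cases hG : G.toUnlabeled ∈ vanishingEnergy
  · rw [Set.indicator_of_mem hG, onClass_step_iterate_maxEnergy, Function.iterate_succ_apply']
    refine G.avg_mono (fun v => ?_) G.root
    refine (Set.indicator_le_self _ _ _).trans_eq (onClass_step_iterate_maxEnergy n _)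
  -- Off the event, every neighbouring root is off it as well, so the average of the indicator
  -- function is zero.
  · rw [Set.indicator_of_notMem hG, nonpos_iff_eq_zero]
    by_cases hn : (G.nbrs G.root).Nonempty
    · rw [avg_of_nonempty hn, Finset.sum_eq_zero, mul_zero]
      exact fun v hv => Set.indicator_of_notMem
        (fun h => hG (mem_vanishingEnergy_of_adj (mem_nbrs.1 hv) h)) _
    · rw [avg_of_empty hn]
      exact Set.indicator_of_notMem hG _

/-- A nondecreasing sequence of nonnegative numbers with limit 0 is identically 0; the bound 4 and
finiteness of `μ` allow dominated convergence. -/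
theorem lintegral_indicator_vanishingEnergy {μ : Measure UnlabeledGraph} [IsFiniteMeasure μ]
    (hμ : UnlabeledGraph.IsStationary μ) (n : ℕ) :
    ∫⁻ x, vanishingEnergy.indicator (onClass (step^[n] maxEnergy)) x ∂μ = 0 := by
  have hmono := monotone_nat_of_le_succ (lintegral_indicator_vanishingEnergy_le hμ)
  have hlim : Filter.Tendsto
      (fun n => ∫⁻ x, vanishingEnergy.indicator (onClass (step^[n] maxEnergy)) x ∂μ)
      Filter.atTop (nhds (∫⁻ _, 0 ∂μ)) := by
    refine tendsto_lintegral_of_dominated_convergence (fun _ => 4)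
      (fun n => (measurable_onClass_step_iterate_maxEnergy n).indicator
        measurableSet_vanishingEnergy)
      (fun n => Filter.Eventually.of_forall fun x => (Set.indicator_le_self _ _ _).trans
        (step_iterate_maxEnergy_le_four n _))
      ?_ (Filter.Eventually.of_forall fun x => ?_)
    · rw [lintegral_const]
      exact ENNReal.mul_ne_top (by simp) (measure_ne_top _ _)
    · by_cases hx : x ∈ vanishingEnergy
      · simp only [Set.indicator_of_mem hx]
        exact hx
      · simp only [Set.indicator_of_notMem hx]
        exact tendsto_const_nhds
  rw [lintegral_zero] at hlim
  exact nonpos_iff_eq_zero.1 (hmono.ge_of_tendsto hlim n)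

end RootedGraph

theorem theorem1p2 (μ : Measure UnlabeledGraph) [IsProbabilityMeasure μ]
    (hμ : UnlabeledGraph.IsStationary μ) :
    ∀ᵐ x ∂μ, ∀ G : RootedGraph, G.toUnlabeled = x →
      Module.rank ℝ G.boundedHarmonic = 1 ∨
        ¬ FiniteDimensional ℝ G.boundedHarmonic := by
  -- One null set serves all `n`; outside it, finite dimension puts the class in the event and so
  -- forces every iterate to vanish.
  have hae : ∀ᵐ x ∂μ, ∀ n, RootedGraph.vanishingEnergy.indicator
      (RootedGraph.onClass (RootedGraph.step^[n] RootedGraph.maxEnergy)) x = 0 :=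
    ae_all_iff.2 fun n => (lintegral_eq_zero_iff
      ((RootedGraph.measurable_onClass_step_iterate_maxEnergy n).indicator
        RootedGraph.measurableSet_vanishingEnergy)).1
      (RootedGraph.lintegral_indicator_vanishingEnergy hμ n)
  filter_upwards [hae] with x hx G hG
  subst hG
  by_cases hfin : FiniteDimensional ℝ G.boundedHarmonic
  · refine Or.inl (RootedGraph.rank_boundedHarmonic_eq_one fun n => ?_)
    have hmem := RootedGraph.mem_vanishingEnergy.2 G.tendsto_step_iterate_maxEnergy
    have := hx n
    rwa [Set.indicator_of_mem hmem, RootedGraph.onClass_step_iterate_maxEnergy] at this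
  · exact Or.inr hfin
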